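/- There is an absolute constant $C>0$ such that the following holds. Let $K\subseteq\mathbb{R}^d$ be a centrally symmetric convex body (compact, convex, $K=-K$) with $B(r)\subseteq K\subseteq B(R)$ for some $r>0$, where $B(\rho)$ denotes the closed Euclidean ball of radius $\rho$ centred at the origin. Let $\mathcal{G}\subseteq\mathbb{R}^d$ be a set of gain vectors such that $G=\max_{g\in\mathcal{G}}\|g\|_2$ exists, and let $\alpha>0$. Consider online linear optimization with hints on $K$: in each round $t$ the algorithm first receives a hint $h_t$ with $\|h_t\|_2=1$, then plays a point $x_t\in K$ that depends only on $h_1,\dots,h_t$ and $g_1,\dots,g_{t-1}$; after that a gain vector $g_t\in\mathcal{G}$ is revealed, for which $\langle h_t,g_t\rangle\ge\alpha\|g_t\|_2$, and the algorithm receives the reward $\langle x_t,g_t\rangle$. Then for every $\varepsilon>0$ there is a deterministic online algorithm (which may depend on $K,r,R,\mathcal{G},\alpha,\varepsilon$, but not on the number of rounds) such that for every $T\ge 2$ and all sequences $h_1,\dots,h_T$ and $g_1,\dots,g_T$ as above $$\sum_{t=1}^T\langle x_t,g_t\rangle\;\ge\;(1-\varepsilon)\,\mathrm{OPT}\;-\;\frac{d\,G\,R^4}{\alpha\,r^3}\cdot\frac{C\,\log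 T}{\varepsilon},\qquad \mathrm{OPT}:=\max_{x\in K}\sum_{t=1}^T\langle x,g_t\rangle .$$ -/

import Mathlib

/-- A deterministic online algorithm for online linear optimization with hints on the playing set
`K`. In round `t` (rounds are numbered from `0`) the algorithm knows the pairs `(hint, gain)` of the
`t` past rounds and the current hint, and it answers with a point of `K`. The gain vector of round
`t` is not available to it. -/
structure HintAlgorithm {d : ℕ} (K : ConvexBody (EuclideanSpace ℝ (Fin d))) where
  /-- `play t past h` is the action in round `t` after the history `past` and the hint `h`. -/
  play : (t : ℕ) → (Fin t → EuclideanSpace ℝ (Fin d) × EuclideanSpace ℝ (Fin d)) →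
    EuclideanSpace ℝ (Fin d) → EuclideanSpace ℝ (Fin d)
  /-- Only feasible actions are played. -/
  play_mem : ∀ t past h, play t past h ∈ K

/-- The action `x_t` of the algorithm against the hints `h` and the gains `g`. -/
def HintAlgorithm.action {d : ℕ} {K : ConvexBody (EuclideanSpace ℝ (Fin d))}
    (A : HintAlgorithm K) (h g : ℕ → EuclideanSpace ℝ (Fin d)) (t : ℕ) :
    EuclideanSpace ℝ (Fin d) :=
  A.play t (fun s => (h s, g s)) (h t)

/-- The total reward `∑_t ⟨x_t, g_t⟩` of the algorithm over the first `T` rounds. -/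
noncomputable def HintAlgorithm.totalReward {d : ℕ} {K : ConvexBody (EuclideanSpace ℝ (Fin d))}
    (A : HintAlgorithm K) (h g : ℕ → EuclideanSpace ℝ (Fin d)) (T : ℕ) : ℝ :=
  ∑ t ∈ Finset.range T, inner ℝ (A.action h g t) (g t)

/-- `OPT`, the maximum over `x ∈ K` of `∑_t ⟨x, g_t⟩` over the first `T` rounds: the reward of the
best fixed action in hindsight. -/
noncomputable def hintOPT {d : ℕ} (K : ConvexBody (EuclideanSpace ℝ (Fin d)))
    (g : ℕ → EuclideanSpace ℝ (Fin d)) (T : ℕ) : ℝ :=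
  sSup ((fun x => ∑ t ∈ Finset.range T, inner ℝ x (g t)) '' (K : Set (EuclideanSpace ℝ (Fin d))))

/-- The supremum that defines `OPT` is attained. -/
theorem hintOPT_isGreatest {d : ℕ} (K : ConvexBody (EuclideanSpace ℝ (Fin d)))
    (g : ℕ → EuclideanSpace ℝ (Fin d)) (T : ℕ) :
    IsGreatest ((fun x => ∑ t ∈ Finset.range T, inner ℝ x (g t)) ''
      (K : Set (EuclideanSpace ℝ (Fin d)))) (hintOPT K g T) :=
  (K.isCompact.image (by fun_prop)).isGreatest_sSup (K.nonempty.image _)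

/-! Projected gradient ascent with step `η` has regret at most `R² / (2η) + (η/2) ∑ ‖g t‖²`, and the
last term is at most `(ηG/2) ∑ ‖g t‖`. Moving weight `ε` onto the point `r • h t` costs a factor `1
- ε` on the ascent reward and earns at least `ε r α ∑ ‖g t‖`. With `η = 2εrα/G` the hint reward
absorbs the second-order term, leaving a loss `G R² / (4εrα)` free of `T` and `d`
(`HintAlgorithm.gradientAscent_totalReward`). This is below the required penalty already for `C = 1`
(`regret_bound_le`). -/

section ConvexBodyProjection

variable {E : Type*} [NormedAddCommGroup E] [InnerProductSpace ℝ E]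

/-- Every point has a nearest point in a convex body, characterized by the obtuse angle
criterion. -/
theorem ConvexBody.exists_inner_sub_le_zero (K : ConvexBody E) (u : E) :
    ∃ v ∈ K, ∀ w ∈ K, inner ℝ (u - v) (w - v) ≤ 0 := by
  obtain ⟨v, hv, h⟩ := exists_norm_eq_iInf_of_complete_convex K.nonempty
    K.isCompact.isComplete K.convex u
  exact ⟨v, hv, (norm_eq_iInf_iff_real_inner_le_zero K.convex hv).1 h⟩

/-- The metric projection onto a convex body. -/
noncomputable def ConvexBody.proj (K : ConvexBody E) (u : E) : E :=
  (K.exists_inner_sub_le_zero u).choose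

theorem ConvexBody.proj_mem (K : ConvexBody E) (u : E) : K.proj u ∈ K :=
  (K.exists_inner_sub_le_zero u).choose_spec.1

theorem ConvexBody.norm_proj_sub_sq_le (K : ConvexBody E) (u : E) {w : E} (hw : w ∈ K) :
    ‖K.proj u - w‖ ^ 2 ≤ ‖u - w‖ ^ 2 := by
  have h : inner ℝ (u - K.proj u) (w - K.proj u) ≤ 0 :=
    (K.exists_inner_sub_le_zero u).choose_spec.2 w hw
  have e : u - w = (u - K.proj u) - (w - K.proj u) := by abel
  rw [e, norm_sub_rev (K.proj u) w, norm_sub_sq_real (u - K.proj u)]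
  nlinarith [sq_nonneg ‖u - K.proj u‖]

/-- Projected online gradient ascent with constant step size `η`, started at the projection of the
origin. -/
noncomputable def ConvexBody.gradientAscent (K : ConvexBody E) (η : ℝ) (g : ℕ → E) : ℕ → E
  | 0 => K.proj 0
  | t + 1 => K.proj (K.gradientAscent η g t + η • g t)

theorem ConvexBody.gradientAscent_mem (K : ConvexBody E) (η : ℝ) (g : ℕ → E) (t : ℕ) :
    K.gradientAscent η g t ∈ K := by
  cases t <;> exact K.proj_mem _

/-- The iterate of round `t` depends only on the gains of earlier rounds. -/
theorem ConvexBody.gradientAscent_congr (K : ConvexBody E) (η : ℝ) {g g' : ℕ → E} {t : ℕ}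
    (h : ∀ s < t, g s = g' s) : K.gradientAscent η g t = K.gradientAscent η g' t := by
  induction t with
  | zero => rfl
  | succ t ih =>
    simp only [gradientAscent]
    rw [ih fun s hs => h s (hs.trans t.lt_succ_self), h t t.lt_succ_self]

/-- The regret bound of projected online gradient ascent, with the potential term kept. -/
theorem ConvexBody.gradientAscent_regret (K : ConvexBody E) (η : ℝ) (g : ℕ → E) {w : E}
    (hw : w ∈ K) (T : ℕ) :
    2 * η * ∑ t ∈ Finset.range T, inner ℝ w (g t) + ‖K.gradientAscent η g T - w‖ ^ 2 ≤
      2 * η * ∑ t ∈ Finset.range T, inner ℝ (K.gradientAscent η g t) (g t) + ‖w‖ ^ 2 +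
        η ^ 2 * ∑ t ∈ Finset.range T, ‖g t‖ ^ 2 := by
  induction T with
  -- Starting at the projection of the origin makes the initial potential at most `‖w‖ ^ 2`.
  | zero => simpa [gradientAscent] using K.norm_proj_sub_sq_le 0 hw
  | succ T ih =>
    have h := K.norm_proj_sub_sq_le (K.gradientAscent η g T + η • g T) hw
    have e : K.gradientAscent η g T + η • g T - w = (K.gradientAscent η g T - w) + η • g T := by
      abel
    rw [e, norm_add_sq_real, inner_smul_right, inner_sub_left, norm_smul, mul_pow,
      Real.norm_eq_abs, sq_abs] at h
    simp only [Finset.sum_range_succ, gradientAscent]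
    linarith

end ConvexBodyProjection

section HintedGradientAscent

variable {d : ℕ} (K : ConvexBody (EuclideanSpace ℝ (Fin d)))

/-- The algorithm that plays the origin in every round. -/
def HintAlgorithm.zero (h0 : 0 ∈ K) : HintAlgorithm K where
  play _ _ _ := 0
  play_mem _ _ _ := h0

/-- The algorithm that mixes projected gradient ascent, with weight `1 - ε`, and a step of length
`r` in the direction of the hint, with weight `ε`. -/
noncomputable def HintAlgorithm.gradientAscent {r ε : ℝ} (η : ℝ) (hr : 0 ≤ r)
    (hK : Metric.closedBall (0 : EuclideanSpace ℝ (Fin d)) r ⊆ (K : Set _))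
    (hε : 0 ≤ ε) (hε' : ε ≤ 1) : HintAlgorithm K where
  play t past h :=
    -- The padding by `0` is harmless: iterate `t` reads only gains before round `t`.
    (1 - ε) • K.gradientAscent η (fun s => if hs : s < t then (past ⟨s, hs⟩).2 else 0) t +
      -- Feasibility is required for every input `h`, so overlong hints are replaced by `0`.
      ε • if ‖h‖ ≤ 1 then r • h else 0
  play_mem t past h := by
    refine K.convex (K.gradientAscent_mem η _ t) (hK ?_) (by linarith) hε (by ring)
    split_ifs with hh
    · rw [mem_closedBall_zero_iff, norm_smul, Real.norm_of_nonneg hr]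
      exact mul_le_of_le_one_right hr hh
    · simpa using hr

theorem HintAlgorithm.gradientAscent_action {r ε : ℝ} (η : ℝ) (hr : 0 ≤ r)
    (hK : Metric.closedBall (0 : EuclideanSpace ℝ (Fin d)) r ⊆ (K : Set _))
    (hε : 0 ≤ ε) (hε' : ε ≤ 1) (h g : ℕ → EuclideanSpace ℝ (Fin d)) (t : ℕ) (ht : ‖h t‖ = 1) :
    (HintAlgorithm.gradientAscent K η hr hK hε hε').action h g t =
      (1 - ε) • K.gradientAscent η g t + ε • r • h t := by
  simp only [HintAlgorithm.action, HintAlgorithm.gradientAscent, ht, le_refl, if_true]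
  rw [K.gradientAscent_congr η (g' := g) fun s hs => by simp [hs]]

/-- Mixing in the hint pays for the second-order term in the regret of gradient ascent. -/
theorem HintAlgorithm.gradientAscent_totalReward {r R ε G α : ℝ} (hr : 0 < r)
    (hK : Metric.closedBall (0 : EuclideanSpace ℝ (Fin d)) r ⊆ (K : Set _))
    (hKR : (K : Set _) ⊆ Metric.closedBall (0 : EuclideanSpace ℝ (Fin d)) R)
    (hε : 0 < ε) (hε' : ε ≤ 1) (hG : 0 < G) (hα : 0 < α)
    (h g : ℕ → EuclideanSpace ℝ (Fin d)) (T : ℕ) (hg : ∀ t < T, ‖g t‖ ≤ G)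
    (hh : ∀ t < T, ‖h t‖ = 1) (hhg : ∀ t < T, α * ‖g t‖ ≤ inner ℝ (h t) (g t)) :
    (1 - ε) * hintOPT K g T - G * R ^ 2 / (4 * ε * r * α) ≤
      (HintAlgorithm.gradientAscent K (2 * ε * r * α / G) hr.le hK hε.le hε').totalReward h g T := by
  set η := 2 * ε * r * α / G with hη
  have hη0 : 0 < η := by positivity
  obtain ⟨w, hw, hwO⟩ := (hintOPT_isGreatest K g T).1
  have hwR : ‖w‖ ^ 2 ≤ R ^ 2 :=
    pow_le_pow_left₀ (norm_nonneg w) (mem_closedBall_zero_iff.1 (hKR hw)) 2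
  have hreg := K.gradientAscent_regret η g hw T
  set S := ∑ t ∈ Finset.range T, inner ℝ (K.gradientAscent η g t) (g t)
  set N := ∑ t ∈ Finset.range T, ‖g t‖
  have hN : 0 ≤ N := Finset.sum_nonneg fun _ _ => norm_nonneg _
  have hsq : ∑ t ∈ Finset.range T, ‖g t‖ ^ 2 ≤ G * N := by
    rw [Finset.mul_sum]
    refine Finset.sum_le_sum fun t ht => ?_
    rw [sq]
    exact mul_le_mul_of_nonneg_right (hg t (Finset.mem_range.1 ht)) (norm_nonneg _)
  have hrew : (1 - ε) * S + ε * r * α * N ≤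
      (HintAlgorithm.gradientAscent K η hr.le hK hε.le hε').totalReward h g T := by
    simp only [HintAlgorithm.totalReward, S, N, Finset.mul_sum, ← Finset.sum_add_distrib]
    refine Finset.sum_le_sum fun t ht => ?_
    rw [Finset.mem_range] at ht
    rw [HintAlgorithm.gradientAscent_action K η hr.le hK hε.le hε' h g t (hh t ht),
      inner_add_left, real_inner_smul_left, real_inner_smul_left, real_inner_smul_left]
    have := mul_le_mul_of_nonneg_left (hhg t ht) (mul_pos hε hr).le
    linarith
  have hOS : hintOPT K g T ≤ S + G * R ^ 2 / (4 * ε * r * α) + ε * r * α * N := by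
    have h1 : 2 * η * hintOPT K g T ≤ 2 * η * S + R ^ 2 + η ^ 2 * (G * N) := by
      rw [← hwO]
      have := mul_le_mul_of_nonneg_left hsq (sq_nonneg η)
      have := sq_nonneg ‖K.gradientAscent η g T - w‖
      linarith
    -- The choice of `η` gives `R² / (2η) = G R² / (4εrα)` and `ηG/2 = εrα`.
    have h2 : 2 * η * S + R ^ 2 + η ^ 2 * (G * N) =
        2 * η * (S + G * R ^ 2 / (4 * ε * r * α) + ε * r * α * N) := by
      rw [hη]
      field_simp
      ring
    exact le_of_mul_le_mul_left (h2 ▸ h1) (by positivity)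
  have h3 := mul_le_mul_of_nonneg_left hOS (sub_nonneg.2 hε')
  -- Scaling the regret by `1 - ε` only shrinks the two error terms; the surplus is dropped.
  have h4 : 0 ≤ ε * (G * R ^ 2 / (4 * ε * r * α)) := by positivity
  have h5 : 0 ≤ ε * (ε * r * α * N) := by positivity
  linarith

end HintedGradientAscent

theorem le_of_closedBall_subset_closedBall {E : Type*} [NormedAddCommGroup E] [NormedSpace ℝ E]
    {K : Set E} {r R : ℝ} (hr : 0 ≤ r) (hK : Metric.closedBall (0 : E) r ⊆ K)
    (hKR : K ⊆ Metric.closedBall (0 : E) R) {v : E} (hv : ‖v‖ = 1) : r ≤ R := by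
  have hn : ‖r • v‖ = r := by rw [norm_smul, hv, mul_one, Real.norm_of_nonneg hr]
  have := hKR (hK (mem_closedBall_zero_iff.2 hn.le))
  rwa [mem_closedBall_zero_iff, hn] at this

/-- The right side is the left side times `4 d (R/r)² log T`, and this factor is at least `1`
because `log 2 > 1/4`. -/
theorem regret_bound_le {d T : ℕ} {r R ε G α : ℝ} (hd : 1 ≤ d) (hT : 2 ≤ T) (hr : 0 < r)
    (hrR : r ≤ R) (hε : 0 < ε) (hG : 0 ≤ G) (hα : 0 < α) :
    G * R ^ 2 / (4 * ε * r * α) ≤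
      (d : ℝ) * G * R ^ 4 / (α * r ^ 3) * (1 * (Real.log T / ε)) := by
  have hlog : 1 / 4 ≤ Real.log T := by
    have h2 : Real.log 2 ≤ Real.log T := Real.log_le_log two_pos (by exact_mod_cast hT)
    linarith [Real.log_two_gt_d9]
  have hd' : (1 : ℝ) ≤ d := by exact_mod_cast hd
  have hR : 1 ≤ R ^ 2 / r ^ 2 :=
    (one_le_div (by positivity)).2 (pow_le_pow_left₀ hr.le hrR 2)
  have hkey : 1 / 4 ≤ d * (R ^ 2 / r ^ 2) * Real.log T :=
    hlog.trans (le_mul_of_one_le_left (by linarith) (one_le_mul_of_one_le_of_one_le hd' hR))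
  calc G * R ^ 2 / (4 * ε * r * α) = G * R ^ 2 / (ε * r * α) * (1 / 4) := by field_simp
    _ ≤ G * R ^ 2 / (ε * r * α) * (d * (R ^ 2 / r ^ 2) * Real.log T) :=
      mul_le_mul_of_nonneg_left hkey (by positivity)
    _ = _ := by field_simp

theorem mainTheorem5 :
    ∃ C : ℝ, 0 < C ∧
      ∀ (d : ℕ) (K : ConvexBody (EuclideanSpace ℝ (Fin d))) (r R : ℝ),
        0 < r →
        (∀ x ∈ K, -x ∈ K) →
        Metric.closedBall (0 : EuclideanSpace ℝ (Fin d)) r ⊆ (K : Set _) →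
        (K : Set _) ⊆ Metric.closedBall (0 : EuclideanSpace ℝ (Fin d)) R →
      ∀ (𝒢 : Set (EuclideanSpace ℝ (Fin d))) (G α : ℝ),
        IsGreatest ((fun v => ‖v‖) '' 𝒢) G →
        0 < α →
      ∀ ε : ℝ, 0 < ε →
        ∃ A : HintAlgorithm K,
          ∀ T : ℕ, 2 ≤ T →
          ∀ h g : ℕ → EuclideanSpace ℝ (Fin d),
            (∀ t < T, g t ∈ 𝒢) →
            (∀ t < T, ‖h t‖ = 1) →
            (∀ t < T, α * ‖g t‖ ≤ inner ℝ (h t) (g t)) →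
            (1 - ε) * hintOPT K g T
                - (d : ℝ) * G * R ^ 4 / (α * r ^ 3) * (C * (Real.log T / ε))
              ≤ A.totalReward h g T := by
  refine ⟨1, one_pos, fun d K r R hr _ hK hKR 𝒢 G α hG hα ε hε => ?_⟩
  have hgG : ∀ v ∈ 𝒢, ‖v‖ ≤ G := fun v hv => hG.2 ⟨v, hv, rfl⟩
  have hG0 : 0 ≤ G := by
    obtain ⟨v, -, rfl⟩ := hG.1
    exact norm_nonneg v
  have h0 : (0 : EuclideanSpace ℝ (Fin d)) ∈ K := hK (Metric.mem_closedBall_self hr.le)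
  -- A unit vector excludes `d = 0`, where the penalty vanishes, and forces `r ≤ R`; the first hint
  -- will supply one.
  have hbound : ∀ T : ℕ, 2 ≤ T → ∀ v : EuclideanSpace ℝ (Fin d), ‖v‖ = 1 →
      G * R ^ 2 / (4 * ε * r * α) ≤
        (d : ℝ) * G * R ^ 4 / (α * r ^ 3) * (1 * (Real.log T / ε)) := by
    intro T hT v hv
    refine regret_bound_le (Nat.one_le_iff_ne_zero.2 ?_) hT hr
      (le_of_closedBall_subset_closedBall hr.le hK hKR hv) hε hG0 hα
    rintro rfl
    rw [Subsingleton.elim v 0, norm_zero] at hv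
    exact zero_ne_one hv
  -- The mixture needs `ε ≤ 1` and the step size needs `G ≠ 0`. Otherwise `(1 - ε) * OPT ≤ 0`, so
  -- playing the origin suffices.
  by_cases hcase : ε ≤ 1 ∧ 0 < G
  · refine ⟨HintAlgorithm.gradientAscent K (2 * ε * r * α / G) hr.le hK hε.le hcase.1,
      fun T hT h g hg hh hhg => ?_⟩
    have h1 := HintAlgorithm.gradientAscent_totalReward K hr hK hKR hε hcase.1 hcase.2 hα h g T
      (fun t ht => hgG _ (hg t ht)) hh hhg
    linarith [hbound T hT (h 0) (hh 0 (by omega))]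
  · refine ⟨HintAlgorithm.zero K h0, fun T hT h g hg hh _ => ?_⟩
    have hrew : (HintAlgorithm.zero K h0).totalReward h g T = 0 := by
      simp [HintAlgorithm.totalReward, HintAlgorithm.action, HintAlgorithm.zero]
    have hpen := hbound T hT (h 0) (hh 0 (by omega))
    have hpos : 0 ≤ G * R ^ 2 / (4 * ε * r * α) := by positivity
    have hOPT : (1 - ε) * hintOPT K g T ≤ 0 := by
      by_cases hε' : ε ≤ 1
      · have hGz : G = 0 := le_antisymm (not_lt.1 fun hp => hcase ⟨hε', hp⟩) hG0
        obtain ⟨w, -, hw⟩ := (hintOPT_isGreatest K g T).1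
        have hz : hintOPT K g T = 0 := by
          rw [← hw]
          refine Finset.sum_eq_zero fun t ht => ?_
          have : g t = 0 :=
            norm_le_zero_iff.1 (hGz ▸ hgG _ (hg t (Finset.mem_range.1 ht)))
          rw [this, inner_zero_right]
        rw [hz, mul_zero]
      · have hO : 0 ≤ hintOPT K g T := (hintOPT_isGreatest K g T).2 ⟨0, h0, by simp⟩
        exact mul_nonpos_of_nonpos_of_nonneg (by linarith) hO
    rw [hrew]
    linarith
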